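/- There is an absolute constant $C$ such that for every alphabet $A$ (of any size), every real $\alpha>1$ and every word $w=w[1]w[2]\cdots w[n]$ of length $n$ over $A$, the number of maximal $\alpha$-gapped repeats in $w$ is at most $C\alpha^2 n$. Here a gapped repeat in $w$ is a factor of $w$ of the form $uvu$ with $u$ and $v$ nonempty words, given together with its left copy $w[i'..j']=u$ and its right copy $w[i''..j'']=u$ (so $j'+1<i''$); its period is $|u|+|v|=i''-i'$, and two gapped repeats that occupy the same positions of $w$ but have different periods are counted as different. It is $\alpha$-gapped if $|u|+|v|\le\alpha|u|$. It is maximal if its copies cannot be extended in $w$ by one letter with the same period, that is, if $w[i'-1]\ne w[i''-1]$ whenever $i'>1$, and $w[j'+1]\ne w[j''+1]$ whenever $j''<n$. -/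

import Mathlib

/-- The factor of `w` that starts at position `i` (positions are counted from `0`)
and has length `l`. -/
def wordFactor {A : Type*} (w : List A) (i l : ℕ) : List A :=
  (w.drop i).take l

/-- The data locating a factorization `uvu` inside a word: the start position (counted from `0`)
of the left copy, the length `|u|` of the copies and the length `|v|` of the gap. Repeats with the
same start and end but with different periods are different. -/
@[ext]
structure RepeatData where
  /-- start position of the left copy -/
  start : ℕ
  /-- length of each of the two copies -/
  copyLen : ℕ
  /-- length of the gap -/
  gapLen : ℕ

namespace RepeatData

/-- The period `|u| + |v|` of the repeat `uvu`. -/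
def period (s : RepeatData) : ℕ := s.copyLen + s.gapLen

/-- The first position after the left copy. -/
def leftStop (s : RepeatData) : ℕ := s.start + s.copyLen

/-- The start position of the right copy. -/
def rightStart (s : RepeatData) : ℕ := s.start + s.period

/-- The first position after the right copy. -/
def rightStop (s : RepeatData) : ℕ := s.rightStart + s.copyLen

/-- `s` locates a gapped repeat `uvu` in `w`: the words `u` and `v` are nonempty, `uvu` lies
inside `w`, and the two copies are equal as words. -/
structure IsGappedRepeat {A : Type*} (w : List A) (s : RepeatData) : Prop where
  copyLen_pos : 0 < s.copyLen
  gapLen_pos : 0 < s.gapLen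
  rightStop_le : s.rightStop ≤ w.length
  copies_eq : wordFactor w s.start s.copyLen = wordFactor w s.rightStart s.copyLen

/-- A gapped repeat is maximal if its copies cannot be extended by one letter, to the left or to
the right, inside `w` with the same period. All the positions read here are positions of `w`. -/
structure IsMaximalGappedRepeat {A : Type*} (w : List A) (s : RepeatData) : Prop
    extends IsGappedRepeat w s where
  left_maximal : 0 < s.start → w[s.start - 1]? ≠ w[s.rightStart - 1]?
  right_maximal : s.rightStop < w.length → w[s.leftStop]? ≠ w[s.rightStop]?

/-- The repeat is `α`-gapped: its period is at most `α` times the length of its copies. -/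
def IsAlphaGapped (α : ℝ) (s : RepeatData) : Prop :=
  (s.period : ℝ) ≤ α * (s.copyLen : ℝ)

end RepeatData

/-- The set of all maximal `α`-gapped repeats in the word `w`. -/
def maximalGappedRepeats {A : Type*} (α : ℝ) (w : List A) : Set RepeatData :=
  {s | s.IsMaximalGappedRepeat w ∧ s.IsAlphaGapped α}

/-! Read the word as a function on ℤ that is `none` outside it, and put N = ⌈α⌉; the bound obtained
is O(N n). Two maximal repeats with equal periods and touching left copies coincide; if the periods
differ by g > 0, then g is a period of the overlap of the left copies.

Hence repeats whose left copy has no large factor of short period are determined by approximate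
start, copy length and period. At copy length about 2^k there are O(n / 2^k) starts and O(N) shapes,
and the sum over k is geometric (`card_le_of_scale`).

Otherwise both copies are nearly covered by runs of a common period q (`exists_runPair`). Either the
left ends or the right ends of these runs differ by exactly the period of the repeat, so the runs
determine it, or maximality puts a run end at a copy end on each side (`classification`). The latter
cases are counted at scale q: within a run no long factor has a period g < q (`eq_of_left_run`,
`eq_of_right_run`), which leaves O(N) repeats per cell of length about q. -/

/-- `f` has period `q` on the interval `[a, b)`. -/
def HasPeriodOn {B : Type*} (f : ℤ → B) (q a b : ℤ) : Prop :=
  ∀ t, a ≤ t → t + q < b → f t = f (t + q)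

/-- `[a, b)` is a maximal interval on which `f` has period `q`, and `q` is its least period. -/
structure IsRun {B : Type*} (f : ℤ → B) (q a b : ℤ) : Prop where
  pos : 0 < q
  per : HasPeriodOn f q a b
  left : f (a - 1) ≠ f (a - 1 + q)
  right : f (b - q) ≠ f b
  least : ∀ g, 0 < g → g < q → ¬ HasPeriodOn f g a b

/-! ### Periodicity and runs -/

section Runs

variable {B : Type*} {f : ℤ → B}

/-- The equation `f t = f (t + g)` holds for at least q consecutive t, hence for every residue mod
q, and the period q carries it across `[a, b)`. -/
theorem HasPeriodOn.extend {q g a b c d : ℤ} (hq : 0 < q) (hg : 0 < g)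
    (h : HasPeriodOn f q a b) (hac : a ≤ c) (hdb : d ≤ b) (h' : HasPeriodOn f g c d)
    (hl : c + q + g ≤ d) : HasPeriodOn f g a b := by
  have up : ∀ m : ℕ, ∀ t, c ≤ t → t + g < b → t ≤ c + m → f t = f (t + g) := by
    intro m
    induction m with
    | zero =>
      intro t h1 h2 h3
      exact h' t h1 (by push_cast at h3; omega)
    | succ m ih =>
      intro t h1 h2 h3
      by_cases h4 : t + g < d
      · exact h' t h1 h4
      have e1 := h (t - q) (by omega) (by omega)
      have e2 := h (t + g - q) (by omega) (by omega)
      have e3 := ih (t - q) (by omega) (by omega) (by push_cast at h3; omega)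
      rw [show t - q + q = t by ring] at e1
      rw [show t + g - q + q = t + g by ring] at e2
      rw [← e1, ← e2, e3]
      congr 1; ring
  have down : ∀ m : ℕ, ∀ t, a ≤ t → t + g < b → c - m ≤ t → f t = f (t + g) := by
    intro m
    induction m with
    | zero =>
      intro t h1 h2 h3
      exact up (t - c).toNat t (by push_cast at h3; omega) h2 (by omega)
    | succ m ih =>
      intro t h1 h2 h3
      by_cases h4 : c ≤ t
      · exact ih t h1 h2 (by omega)
      have e1 := h t (by omega) (by omega)
      have e2 := h (t + g) (by omega) (by omega)
      have e3 := ih (t + q) (by omega) (by omega) (by push_cast at h3; omega)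
      rw [e1, e2, e3]
      congr 1; ring
  intro t h1 h2
  exact down (c - t).toNat t h1 h2 (by omega)

/-- Inside a run there is no long factor with a smaller period. -/
theorem IsRun.not_hasPeriodOn {q g a b c d : ℤ} (h : IsRun f q a b) (hg : 0 < g) (hgq : g < q)
    (hac : a ≤ c) (hdb : d ≤ b) (hl : c + q + g ≤ d) : ¬ HasPeriodOn f g c d :=
  fun h' => h.least g hg hgq (h.per.extend h.pos hg hac hdb h' hl)

/-- Two runs that share a factor at least as long as the sum of their periods coincide. -/
theorem IsRun.unique {q₁ q₂ a₁ b₁ a₂ b₂ c d : ℤ} (h₁ : IsRun f q₁ a₁ b₁) (h₂ : IsRun f q₂ a₂ b₂)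
    (ha₁ : a₁ ≤ c) (ha₂ : a₂ ≤ c) (hb₁ : d ≤ b₁) (hb₂ : d ≤ b₂) (hl : c + q₁ + q₂ ≤ d) :
    q₁ = q₂ ∧ a₁ = a₂ ∧ b₁ = b₂ := by
  have p₁ := h₁.pos
  have p₂ := h₂.pos
  have hq : q₁ = q₂ := by
    rcases lt_trichotomy q₁ q₂ with h | h | h
    · exact absurd (fun t u v => h₁.per t (by omega) (by omega))
        (h₂.not_hasPeriodOn p₁ h ha₂ hb₂ (by omega))
    · exact h
    · exact absurd (fun t u v => h₂.per t (by omega) (by omega))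
        (h₁.not_hasPeriodOn p₂ h ha₁ hb₁ (by omega))
  subst hq
  refine ⟨rfl, ?_, ?_⟩
  · rcases lt_trichotomy a₁ a₂ with h | h | h
    · exact absurd (h₁.per (a₂ - 1) (by omega) (by omega)) h₂.left
    · exact h
    · exact absurd (h₂.per (a₁ - 1) (by omega) (by omega)) h₁.left
  · rcases lt_trichotomy b₁ b₂ with h | h | h
    · have := h₂.per (b₁ - q₁) (by omega) (by omega)
      rw [sub_add_cancel] at this
      exact absurd this h₁.right
    · exact h
    · have := h₁.per (b₂ - q₁) (by omega) (by omega)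
      rw [sub_add_cancel] at this
      exact absurd this h₂.right

/-- A periodic factor of a function supported on `[0, n)` extends to a run. -/
theorem exists_isRun {A : Type*} {f : ℤ → Option A} {n q c d : ℤ}
    (hf : ∀ t, f t = none ↔ t < 0 ∨ n ≤ t) (hc : 0 ≤ c) (hd : d ≤ n) (hq : 0 < q)
    (hl : c + q ≤ d) (hper : HasPeriodOn f q c d)
    (hmin : ∀ g, 0 < g → g < q → ¬ HasPeriodOn f g c d) :
    ∃ a b, a ≤ c ∧ d ≤ b ∧ IsRun f q a b := by
  have ne : ∀ s t, (s < 0 ∨ n ≤ s) → 0 ≤ t → t < n → f s ≠ f t := by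
    intro s t hs h0 h1 h
    have := (hf t).1 (h ▸ (hf s).2 hs)
    omega
  -- The extension stops on both sides, at the latest where a letter is compared with `none`.
  obtain ⟨u, ⟨hu, hu'⟩, hmax⟩ := Int.exists_greatest_of_bdd
    (P := fun t => t < c ∧ f t ≠ f (t + q)) ⟨c, fun z hz => hz.1.le⟩
    ⟨-1, by omega, ne _ _ (by omega) (by omega) (by omega)⟩
  obtain ⟨v, ⟨hv, hv'⟩, hleast⟩ := Int.exists_least_of_bdd
    (P := fun t => d ≤ t ∧ f (t - q) ≠ f t) ⟨d, fun z hz => hz.1⟩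
    ⟨n, hd, (ne _ _ (by omega) (by omega) (by omega)).symm⟩
  refine ⟨u + 1, v, by omega, hv, hq, ?_, by simpa using hu', hv', ?_⟩
  · intro t h1 h2
    by_contra h
    by_cases h3 : t < c
    · have := hmax t ⟨h3, h⟩
      omega
    by_cases h4 : t + q < d
    · exact h (hper t (by omega) h4)
    · have := hleast (t + q) ⟨by omega, by simpa using h⟩
      omega
  · intro g h1 h2 h3
    exact hmin g h1 h2 fun t h4 h5 => h3 t (by omega) (by omega)

end Runs

/-! ### Words as functions on the integers -/

/-- The function on `ℤ` that reads the letters of `w` and is `none` outside `w`. -/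
def letterAt {A : Type*} (w : List A) (t : ℤ) : Option A :=
  if 0 ≤ t then w[t.toNat]? else none

theorem letterAt_eq_none {A : Type*} (w : List A) (t : ℤ) :
    letterAt w t = none ↔ t < 0 ∨ (w.length : ℤ) ≤ t := by
  unfold letterAt
  split_ifs with h
  · rw [List.getElem?_eq_none_iff]; omega
  · simp; omega

theorem letterAt_natCast {A : Type*} (w : List A) (t : ℕ) : letterAt w t = w[t]? := by
  simp [letterAt]

/-- The position, maximality and gap conditions on a maximal repeat, with integer positions. -/
structure IsMaxRepeat {A : Type*} (f : ℤ → Option A) (n N : ℤ) (s : RepeatData) : Prop where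
  copyLen_pos : (0 : ℤ) < s.copyLen
  lt_period : (s.copyLen : ℤ) < s.period
  end_le : (s.start : ℤ) + s.period + s.copyLen ≤ n
  period_le : (s.period : ℤ) ≤ N * s.copyLen
  eq : ∀ t : ℤ, s.start ≤ t → t < s.start + s.copyLen → f t = f (t + s.period)
  left : f ((s.start : ℤ) - 1) ≠ f ((s.start : ℤ) - 1 + s.period)
  right : f ((s.start : ℤ) + s.copyLen) ≠ f ((s.start : ℤ) + s.copyLen + s.period)

/-- The boundary guards in the maximality conditions disappear because `none` differs from every
letter. -/
theorem RepeatData.IsMaximalGappedRepeat.isMaxRepeat {A : Type*} {w : List A} {s : RepeatData}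
    (h : s.IsMaximalGappedRepeat w) {N : ℕ} (hN : s.period ≤ N * s.copyLen) :
    IsMaxRepeat (letterAt w) w.length N s := by
  have h1 := h.copyLen_pos
  have h2 := h.gapLen_pos
  have h3 := h.rightStop_le
  have hp : s.period = s.copyLen + s.gapLen := rfl
  have hr : s.rightStart = s.start + s.period := rfl
  have hs : s.rightStop = s.start + s.period + s.copyLen := rfl
  have hls : s.leftStop = s.start + s.copyLen := rfl
  refine ⟨by omega, by omega, by omega, by exact_mod_cast hN, ?_, ?_, ?_⟩
  · intro t ht1 ht2
    obtain ⟨j, rfl⟩ : ∃ j : ℕ, t = (s.start + j : ℕ) := ⟨(t - s.start).toNat, by omega⟩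
    have hj : j < s.copyLen := by omega
    have := congrArg (fun l => l[j]?) h.copies_eq
    simp only [wordFactor, List.getElem?_take, List.getElem?_drop, hj, if_true, hr] at this
    rw [letterAt_natCast, this, ← letterAt_natCast]
    congr 1; push_cast; ring
  · by_cases h0 : 0 < s.start
    · have := h.left_maximal h0
      rw [← letterAt_natCast, ← letterAt_natCast] at this
      rwa [show (s.start : ℤ) - 1 + s.period = (s.rightStart - 1 : ℕ) by omega,
        show (s.start : ℤ) - 1 = (s.start - 1 : ℕ) by omega]
    · rw [(letterAt_eq_none w _).2 (by omega)]
      intro he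
      have := (letterAt_eq_none w _).1 he.symm
      omega
  · by_cases h0 : s.rightStop < w.length
    · have := h.right_maximal h0
      rw [← letterAt_natCast, ← letterAt_natCast] at this
      rwa [show (s.start : ℤ) + s.copyLen + s.period = s.rightStop by omega,
        show (s.start : ℤ) + s.copyLen = s.leftStop by omega]
    · rw [(letterAt_eq_none w (_ + _ + _)).2 (by omega)]
      intro he
      have := (letterAt_eq_none w _).1 he
      omega

/-! ### Rigidity of maximal repeats -/

section Repeats

variable {A : Type*} {f : ℤ → Option A} {n N : ℤ} {s t : RepeatData}

/-- If the ends differed, the letter just beyond one left copy would lie in the other left copy,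
whose matching extends the first. -/
theorem IsMaxRepeat.eq_of_period_eq (hs : IsMaxRepeat f n N s) (ht : IsMaxRepeat f n N t)
    (hp : (s.period : ℤ) = t.period) (h₁ : (s.start : ℤ) ≤ t.start + t.copyLen)
    (h₂ : (t.start : ℤ) ≤ s.start + s.copyLen) : s = t := by
  have hi : (s.start : ℤ) = t.start := by
    rcases lt_trichotomy (s.start : ℤ) t.start with h | h | h
    · have := hs.eq (t.start - 1) (by omega) (by omega)
      rw [hp] at this
      exact absurd this ht.left
    · exact h
    · have := ht.eq (s.start - 1) (by omega) (by omega)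
      rw [← hp] at this
      exact absurd this hs.left
  have hl : (s.copyLen : ℤ) = t.copyLen := by
    have p₁ := hs.copyLen_pos
    have p₂ := ht.copyLen_pos
    rcases lt_trichotomy (s.copyLen : ℤ) t.copyLen with h | h | h
    · have := ht.eq (s.start + s.copyLen) (by omega) (by omega)
      rw [← hp] at this
      exact absurd this hs.right
    · exact h
    · have := hs.eq (t.start + t.copyLen) (by omega) (by omega)
      rw [hp] at this
      exact absurd this ht.right
  unfold RepeatData.period at hp
  ext <;> omega

/-- If the left copies lie in one run with period `q`, the periods differ by less than `q` and the
right copies overlap in at least `q` letters, then the repeats coincide. -/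
theorem IsMaxRepeat.eq_of_left_run {q a b : ℤ} (hs : IsMaxRepeat f n N s)
    (ht : IsMaxRepeat f n N t) (hr : IsRun f q a b)
    (hs₁ : a ≤ s.start) (hs₂ : s.start + s.copyLen ≤ b)
    (ht₁ : a ≤ t.start) (ht₂ : t.start + t.copyLen ≤ b)
    (h₁ : (s.period : ℤ) - t.period < q) (h₂ : (t.period : ℤ) - s.period < q)
    (o₁ : (s.start : ℤ) + s.period + q ≤ t.start + t.period + t.copyLen)
    (o₂ : (t.start : ℤ) + t.period + q ≤ s.start + s.period + s.copyLen)
    (o₃ : q ≤ s.copyLen) (o₄ : q ≤ t.copyLen) : s = t := by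
  wlog hle : (t.period : ℤ) ≤ s.period generalizing s t
  · exact (this ht hs ht₁ ht₂ hs₁ hs₂ h₂ h₁ o₂ o₁ o₄ o₃ (by omega)).symm
  rcases hle.eq_or_lt with h | h
  · exact hs.eq_of_period_eq ht h.symm (by omega) (by omega)
  exfalso
  -- With g the difference of the periods: if x and x + g are in `[c, d)`, then x is in the left
  -- copy of `s` and x + g in that of `t`, and both are matched with x + `s.period`.
  refine hr.not_hasPeriodOn (g := s.period - t.period) (by omega) h₁
    (c := max (s.start : ℤ) (t.start + t.period - s.period))
    (d := min ((s.start : ℤ) + s.copyLen + s.period - t.period) (t.start + t.copyLen))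
    (by omega) (by omega) (by omega) ?_
  intro x hx hx'
  rw [hs.eq x (by omega) (by omega), ht.eq (x + (s.period - t.period)) (by omega) (by omega)]
  congr 1; ring

/-- If the right copies lie in one run with period `q`, the periods differ by less than `q` and the
left copies overlap in at least `q` letters, then the repeats coincide. -/
theorem IsMaxRepeat.eq_of_right_run {q a b : ℤ} (hs : IsMaxRepeat f n N s)
    (ht : IsMaxRepeat f n N t) (hr : IsRun f q a b)
    (hs₁ : a ≤ s.start + s.period) (hs₂ : s.start + s.period + s.copyLen ≤ b)
    (ht₁ : a ≤ t.start + t.period) (ht₂ : t.start + t.period + t.copyLen ≤ b)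
    (h₁ : (s.period : ℤ) - t.period < q) (h₂ : (t.period : ℤ) - s.period < q)
    (o₁ : (s.start : ℤ) + q ≤ t.start + t.copyLen)
    (o₂ : (t.start : ℤ) + q ≤ s.start + s.copyLen)
    (o₃ : q ≤ s.copyLen) (o₄ : q ≤ t.copyLen) : s = t := by
  wlog hle : (t.period : ℤ) ≤ s.period generalizing s t
  · exact (this ht hs ht₁ ht₂ hs₁ hs₂ h₂ h₁ o₂ o₁ o₄ o₃ (by omega)).symm
  have hq := hr.pos
  rcases hle.eq_or_lt with h | h
  · exact hs.eq_of_period_eq ht h.symm (by omega) (by omega)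
  exfalso
  -- A position y in both left copies gives f (y + `t.period`) = f y = f (y + `s.period`).
  refine hr.not_hasPeriodOn (g := s.period - t.period) (by omega) h₁
    (c := max (s.start : ℤ) t.start + t.period)
    (d := min ((s.start : ℤ) + s.copyLen) (t.start + t.copyLen) + s.period)
    (by omega) (by omega) (by omega) ?_
  intro x hx hx'
  have e₁ := hs.eq (x - t.period) (by omega) (by omega)
  have e₂ := ht.eq (x - t.period) (by omega) (by omega)
  rw [sub_add_cancel] at e₂
  rw [← e₂, e₁]
  congr 1; ring

end Repeats

/-! ### Runs around the copies of a repeat -/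

/-- The two copies of `s` are covered, up to a quarter of their length at either end, by the runs
`[a, b)` and `[a', b')`, which have the same period `q`, and this period is short. -/
structure RunPair {A : Type*} (f : ℤ → Option A) (s : RepeatData) (q a b a' b' : ℤ) : Prop where
  run : IsRun f q a b
  run' : IsRun f q a' b'
  short : 16 * q ≤ s.copyLen
  left_le : 4 * a ≤ 4 * s.start + s.copyLen
  le_right : 4 * (s.start : ℤ) + 3 * s.copyLen ≤ 4 * b
  left_le' : 4 * a' ≤ 4 * (s.start + s.period) + s.copyLen
  le_right' : 4 * ((s.start : ℤ) + s.period) + 3 * s.copyLen ≤ 4 * b'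

/-- The two copies of `s` lie in the runs `[a, b)` and `[a', b')`, which have the same short
period `q`. -/
structure InnerRunPair {A : Type*} (f : ℤ → Option A) (s : RepeatData) (q a b a' b' : ℤ) :
    Prop where
  run : IsRun f q a b
  run' : IsRun f q a' b'
  short : 16 * q ≤ s.copyLen
  left_le : a ≤ s.start
  le_right : (s.start : ℤ) + s.copyLen ≤ b
  left_le' : a' ≤ s.start + s.period
  le_right' : (s.start : ℤ) + s.period + s.copyLen ≤ b'

/-- A large factor of the left copy of `s` has a short period. -/
def HasPeriodicCore {A : Type*} (f : ℤ → Option A) (s : RepeatData) : Prop :=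
  ∃ q c d : ℤ, 0 < q ∧ 16 * q ≤ s.copyLen ∧ s.start ≤ c ∧ d ≤ s.start + s.copyLen ∧
    3 * s.copyLen ≤ 4 * (d - c) ∧ HasPeriodOn f q c d

section Classification

variable {A : Type*} {f : ℤ → Option A} {n N : ℤ} {s : RepeatData}

/-- The core and its translate in the right copy have the same least period, so both extend to runs
with that period. As the core fills three quarters of the copy, it omits at most a quarter at either
end. -/
theorem IsMaxRepeat.exists_runPair (hf : ∀ t, f t = none ↔ t < 0 ∨ n ≤ t)
    (hs : IsMaxRepeat f n N s) (h : HasPeriodicCore f s) :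
    ∃ q a b a' b', RunPair f s q a b a' b' := by
  obtain ⟨q₀, c, d, hq₀, hshort, hc, hd, hcd, hper₀⟩ := h
  obtain ⟨q, ⟨hq, hper⟩, hleast⟩ := Int.exists_least_of_bdd
    (P := fun q => 0 < q ∧ HasPeriodOn f q c d) ⟨0, fun z hz => hz.1.le⟩ ⟨q₀, hq₀, hper₀⟩
  have hqq := hleast q₀ ⟨hq₀, hper₀⟩
  have h0 := hs.end_le
  have h1 := hs.lt_period
  obtain ⟨a, b, ha, hb, hr⟩ := exists_isRun hf (by omega) (by omega) hq (by omega) hper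
    fun g hg hgq hg' => by have := hleast g ⟨hg, hg'⟩; omega
  have shift : ∀ g, 0 < g → (HasPeriodOn f g c d ↔
      HasPeriodOn f g (c + s.period) (d + s.period)) := by
    intro g hg
    constructor
    · intro h t h2 h3
      have e := h (t - s.period) (by omega) (by omega)
      rw [hs.eq _ (by omega) (by omega), hs.eq (t - s.period + g) (by omega) (by omega)] at e
      convert e using 2 <;> ring
    · intro h t h2 h3
      rw [hs.eq t (by omega) (by omega), hs.eq (t + g) (by omega) (by omega),
        h _ (by omega) (by omega)]
      congr 1; ring
  obtain ⟨a', b', ha', hb', hr'⟩ := exists_isRun (c := c + s.period) (d := d + s.period) hf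
    (by omega) (by omega) hq (by omega) ((shift q hq).1 hper)
    fun g hg hgq hg' => by have := hleast g ⟨hg, (shift g hg).2 hg'⟩; omega
  exact ⟨q, a, b, a', b', hr, hr', by omega, by omega, by omega, by omega, by omega⟩

/-- If the run starts are not translates, the later one cannot lie inside its copy, since the other
run would transport the period past it. If both runs started strictly before the copies, their
periodicity would extend the repeat to the left. -/
theorem RunPair.left_cases {q a b a' b' : ℤ} (h : RunPair f s q a b a' b')
    (hs : IsMaxRepeat f n N s) :
    a' = a + s.period ∨ (a ≤ s.start ∧ a' ≤ s.start + s.period ∧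
      (a = s.start ∨ a' = s.start + s.period)) := by
  obtain ⟨hr, hr', hsh, h1, h2, h3, h4⟩ := h
  have hq := hr.pos
  rcases lt_trichotomy a' (a + s.period) with h | h | h
  · refine Or.inr ?_
    have ha : a ≤ s.start := by
      by_contra hc
      apply hr.left
      rw [hs.eq (a - 1) (by omega) (by omega), hs.eq (a - 1 + q) (by omega) (by omega),
        hr'.per _ (by omega) (by omega)]
      congr 1; ring
    refine ⟨ha, by omega, ?_⟩
    by_contra! hc
    apply hs.left
    rw [hr.per _ (by omega) (by omega), hs.eq _ (by omega) (by omega),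
      hr'.per (s.start - 1 + s.period) (by omega) (by omega)]
    congr 1; ring
  · exact Or.inl h
  · refine Or.inr ?_
    have ha : a' ≤ s.start + s.period := by
      by_contra hc
      apply hr'.left
      have e1 := hs.eq (a' - 1 - s.period) (by omega) (by omega)
      have e2 := hs.eq (a' - 1 + q - s.period) (by omega) (by omega)
      have e3 := hr.per (a' - 1 - s.period) (by omega) (by omega)
      rw [sub_add_cancel] at e1 e2
      rw [← e1, ← e2, e3]
      congr 1; ring
    refine ⟨by omega, ha, ?_⟩
    by_contra! hc
    apply hs.left
    rw [hr.per _ (by omega) (by omega), hs.eq _ (by omega) (by omega),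
      hr'.per (s.start - 1 + s.period) (by omega) (by omega)]
    congr 1; ring

theorem RunPair.right_cases {q a b a' b' : ℤ} (h : RunPair f s q a b a' b')
    (hs : IsMaxRepeat f n N s) :
    b' = b + s.period ∨ ((s.start : ℤ) + s.copyLen ≤ b ∧
      (s.start : ℤ) + s.period + s.copyLen ≤ b' ∧
      (b = s.start + s.copyLen ∨ b' = s.start + s.period + s.copyLen)) := by
  obtain ⟨hr, hr', hsh, h1, h2, h3, h4⟩ := h
  have hq := hr.pos
  have key : (s.start : ℤ) + s.copyLen ≤ b → (s.start : ℤ) + s.period + s.copyLen ≤ b' →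
      (b = s.start + s.copyLen ∨ b' = s.start + s.period + s.copyLen) := by
    intro u v
    by_contra! hc
    apply hs.right
    have e1 := hr.per (s.start + s.copyLen - q) (by omega) (by omega)
    have e2 := hr'.per (s.start + s.copyLen + s.period - q) (by omega) (by omega)
    have e3 := hs.eq (s.start + s.copyLen - q) (by omega) (by omega)
    rw [sub_add_cancel] at e1 e2
    rw [← e1, ← e2, e3]
    congr 1; ring
  rcases lt_trichotomy b' (b + s.period) with h | h | h
  · refine Or.inr ?_
    have ha : (s.start : ℤ) + s.period + s.copyLen ≤ b' := by
      by_contra hc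
      apply hr'.right
      have e1 := hs.eq (b' - q - s.period) (by omega) (by omega)
      have e2 := hs.eq (b' - s.period) (by omega) (by omega)
      have e3 := hr.per (b' - q - s.period) (by omega) (by omega)
      rw [sub_add_cancel] at e1 e2
      rw [← e1, ← e2, e3]
      congr 1; ring
    exact ⟨by omega, ha, key (by omega) ha⟩
  · exact Or.inl h
  · refine Or.inr ?_
    have ha : (s.start : ℤ) + s.copyLen ≤ b := by
      by_contra hc
      apply hr.right
      rw [hs.eq (b - q) (by omega) (by omega), hs.eq b (by omega) (by omega),
        hr'.per _ (by omega) (by omega)]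
      congr 1; ring
    exact ⟨ha, by omega, key ha (by omega)⟩

/-- The possible positions of a maximal repeat relative to the runs around its copies. -/
theorem IsMaxRepeat.classification (hf : ∀ t, f t = none ↔ t < 0 ∨ n ≤ t)
    (hs : IsMaxRepeat f n N s) :
    ¬ HasPeriodicCore f s ∨
    (∃ q a b a' b', RunPair f s q a b a' b' ∧ a' = a + s.period) ∨
    (∃ q a b a' b', RunPair f s q a b a' b' ∧ b' = b + s.period) ∨
    (∃ q a b a' b', InnerRunPair f s q a b a' b' ∧ a = s.start ∧
      b' = s.start + s.period + s.copyLen) ∨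
    (∃ q a b a' b', InnerRunPair f s q a b a' b' ∧ a' = s.start + s.period ∧
      b = s.start + s.copyLen) ∨
    (∃ q a b, IsRun f q a b ∧ 16 * q ≤ s.copyLen ∧ a = s.start ∧ b = s.start + s.copyLen) ∨
    (∃ q a b, IsRun f q a b ∧ 16 * q ≤ s.copyLen ∧ a = s.start + s.period ∧
      b = s.start + s.period + s.copyLen) := by
  by_cases hc : HasPeriodicCore f s
  swap
  · exact Or.inl hc
  obtain ⟨q, a, b, a', b', h⟩ := hs.exists_runPair hf hc
  rcases h.left_cases hs with hl | ⟨l1, l2, l3⟩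
  · exact Or.inr (Or.inl ⟨q, a, b, a', b', h, hl⟩)
  rcases h.right_cases hs with hr | ⟨r1, r2, r3⟩
  · exact Or.inr (Or.inr (Or.inl ⟨q, a, b, a', b', h, hr⟩))
  have hi : InnerRunPair f s q a b a' b' := ⟨h.run, h.run', h.short, l1, r1, l2, r2⟩
  refine Or.inr (Or.inr (Or.inr ?_))
  -- If the same copy meets its run at both ends, that copy is a run.
  rcases l3 with l3 | l3 <;> rcases r3 with r3 | r3
  · exact Or.inr (Or.inr (Or.inl ⟨q, a, b, h.run, h.short, l3, r3⟩))
  · exact Or.inl ⟨q, a, b, a', b', hi, l3, r3⟩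
  · exact Or.inr (Or.inl ⟨q, a, b, a', b', hi, l3, r3⟩)
  · exact Or.inr (Or.inr (Or.inr ⟨q, a', b', h.run', h.short, l3, r3⟩))

end Classification

/-! ### Counting over dyadic scales -/

/-- A finite family is small if each member has a dyadic scale `2 ^ k ≤ n` and a position `x < n`
such that few members of the same scale are close to each other. -/
theorem card_le_of_scale {ι : Type*} (S : Finset ι) (k x : ι → ℕ) (c M n : ℕ)
    (hk : ∀ s ∈ S, 2 ^ k s ≤ n) (hx : ∀ s ∈ S, x s < n)
    (hF : ∀ F ⊆ S, (∀ s ∈ F, ∀ t ∈ F, k s = k t ∧ c * x s < c * x t + 2 ^ k s) → F.card ≤ M) :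
    S.card ≤ M * (2 * ((c + 1) * n)) := by
  classical
  let T : Finset (Σ _ : ℕ, ℕ) :=
    ((Finset.range n).filter fun k => 2 ^ k ≤ n).sigma fun k => Finset.range (c * n / 2 ^ k + 1)
  have hT : T.card ≤ 2 * ((c + 1) * n) := by
    rw [Finset.card_sigma]
    calc _ ≤ ∑ k ∈ (Finset.range n).filter (fun k => 2 ^ k ≤ n), (c + 1) * n / 2 ^ k := by
          -- The extra cell at each scale is absorbed by n / 2 ^ k, as 2 ^ k ≤ n.
          refine Finset.sum_le_sum fun k hk => ?_
          rw [Finset.card_range, ← Nat.add_div_right _ (by positivity)]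
          refine Nat.div_le_div_right ?_
          have := (Finset.mem_filter.1 hk).2
          rw [add_mul, one_mul]
          omega
      _ ≤ ∑ k ∈ Finset.range n, (c + 1) * n / 2 ^ k :=
          Finset.sum_le_sum_of_subset (Finset.filter_subset _ _)
      _ ≤ (c + 1) * n * 2 / (2 - 1) := Nat.geom_sum_le le_rfl _ _
      _ = 2 * ((c + 1) * n) := by simp [mul_comm]
  refine (Finset.card_le_mul_card_image_of_maps_to (t := T)
    (f := fun s => (⟨k s, c * x s / 2 ^ k s⟩ : Σ _ : ℕ, ℕ)) ?_ M ?_).trans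
      (Nat.mul_le_mul_left M hT)
  · intro s hs
    have h1 := hk s hs
    simp only [T, Finset.mem_sigma, Finset.mem_filter, Finset.mem_range, h1, and_true]
    refine ⟨(Nat.lt_two_pow_self).trans_le h1, Nat.lt_succ_of_le (Nat.div_le_div_right ?_)⟩
    exact Nat.mul_le_mul_left c (hx s hs).le
  · rintro ⟨k₀, m⟩ -
    refine hF _ (Finset.filter_subset _ _) ?_
    intro s hs t ht
    have hs' := (Finset.mem_filter.1 hs).2
    have ht' := (Finset.mem_filter.1 ht).2
    simp only [Sigma.mk.injEq, heq_eq_eq] at hs' ht'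
    obtain ⟨rfl, e₁⟩ := hs'
    obtain ⟨h, e₂⟩ := ht'
    rw [h] at e₂
    refine ⟨h.symm, ?_⟩
    have p : 0 < 2 ^ k s := by positivity
    have a₁ := Nat.div_add_mod (c * x s) (2 ^ k s)
    have a₂ := Nat.div_add_mod (c * x t) (2 ^ k s)
    have a₃ := Nat.mod_lt (c * x s) p
    rw [e₁] at a₁
    rw [e₂] at a₂
    omega

theorem card_le_of_int_key {ι : Type*} (F : Finset ι) (g : ι → ℤ) (M : ℕ)
    (h₀ : ∀ s ∈ F, 0 ≤ g s) (h₁ : ∀ s ∈ F, g s < M) (hg : ∀ s ∈ F, ∀ t ∈ F, g s = g t → s = t) :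
    F.card ≤ M := by
  have := Finset.card_le_card_of_injOn (s := F) (t := Finset.Ico (0 : ℤ) M) g
    (fun s hs => Finset.mem_coe.2 (Finset.mem_Ico.2 ⟨h₀ s hs, h₁ s hs⟩))
    (fun s hs t ht h => hg s hs t ht h)
  simpa using this

theorem Int.sub_lt_of_ediv_eq {x y Q : ℤ} (hQ : 0 < Q) (h : x / Q = y / Q) : x - y < Q := by
  have a₁ := Int.mul_ediv_add_emod x Q
  have a₂ := Int.mul_ediv_add_emod y Q
  have a₃ := Int.emod_lt_of_pos x hQ
  have a₄ := Int.emod_nonneg y hQ.ne'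
  rw [h] at a₁
  omega

theorem two_pow_log_toNat {q : ℤ} (hq : 0 < q) :
    (2 : ℤ) ^ Nat.log 2 q.toNat ≤ q ∧ q < 2 * 2 ^ Nat.log 2 q.toNat := by
  have h₁ := Nat.pow_log_le_self 2 (x := q.toNat) (by omega)
  have h₂ := Nat.lt_pow_succ_log_self (b := 2) (by norm_num) q.toNat
  rw [pow_succ] at h₂
  zify at h₁ h₂
  rw [Int.toNat_of_nonneg hq.le] at h₁ h₂
  exact ⟨h₁, by linarith⟩

/-! ### Repeats counted at the scale of the copy length -/

section Counting

variable {A : Type*} {f : ℤ → Option A} {n N : ℕ}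

/-- Maximal repeats that are determined by their approximate position, length and period. -/
theorem card_le_of_close (S : Finset RepeatData) (hS : ∀ s ∈ S, IsMaxRepeat f n N s)
    (hclose : ∀ s ∈ S, ∀ t ∈ S, ∀ U : ℤ, U ≤ s.copyLen → U ≤ t.copyLen →
      16 * (s.start : ℤ) < 16 * t.start + U → 16 * (t.start : ℤ) < 16 * s.start + U →
      16 * (s.copyLen : ℤ) < 16 * t.copyLen + U → 16 * (t.copyLen : ℤ) < 16 * s.copyLen + U →
      16 * (s.period : ℤ) < 16 * t.period + U → 16 * (t.period : ℤ) < 16 * s.period + U →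
      s = t) :
    S.card ≤ (32 * (32 * N + 1)) * (2 * ((16 + 1) * n)) := by
  refine card_le_of_scale S (fun s => Nat.log 2 s.copyLen) (fun s => s.start) 16 _ n ?_ ?_ ?_
  · intro s hs
    have h₁ := (hS s hs).copyLen_pos
    have h₂ := (hS s hs).end_le
    have := Nat.pow_log_le_self 2 (x := s.copyLen) (by omega)
    omega
  · intro s hs
    have h₁ := (hS s hs).copyLen_pos
    have h₂ := (hS s hs).end_le
    omega
  intro F hFS hF
  rcases F.eq_empty_or_nonempty with rfl | ⟨r, hr⟩
  · simp
  obtain ⟨U, hU⟩ : ∃ U, U = 2 ^ Nat.log 2 r.copyLen := ⟨_, rfl⟩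
  have hpos : 0 < U := by rw [hU]; positivity
  have hlen : ∀ s ∈ F, U ≤ s.copyLen ∧ s.copyLen < 2 * U := by
    intro s hs
    have h₁ := (hS s (hFS hs)).copyLen_pos
    rw [hU, ← (hF s hs r hr).1]
    refine ⟨Nat.pow_log_le_self 2 (by omega), ?_⟩
    have := Nat.lt_pow_succ_log_self (b := 2) (by norm_num) s.copyLen
    rwa [pow_succ, mul_comm] at this
  -- Lengths are below 2U and periods at most N times the length, so in units of U / 16 there are 32
  -- and 32N + 1 classes.
  have hcard := Finset.card_le_card_of_injOn (s := F)
    (t := Finset.range 32 ×ˢ Finset.range (32 * N + 1))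
    (fun s => (16 * s.copyLen / U, 16 * s.period / U)) ?_ ?_
  · simpa using hcard
  · intro s hs
    obtain ⟨h₁, h₂⟩ := hlen s hs
    have h₃ : s.period ≤ N * s.copyLen := by exact_mod_cast (hS s (hFS hs)).period_le
    have h₄ : N * s.copyLen ≤ N * (2 * U) := Nat.mul_le_mul_left _ h₂.le
    simp only [Finset.coe_product, Finset.coe_range, Set.mem_prod, Set.mem_Iio]
    refine ⟨(Nat.div_lt_iff_lt_mul hpos).2 (by omega), Nat.lt_succ_of_le ?_⟩
    refine Nat.div_le_of_le_mul ?_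
    calc 16 * s.period ≤ 16 * (N * (2 * U)) := by omega
      _ = U * (32 * N) := by ring
  · intro s hs t ht hst
    obtain ⟨h₁, h₂⟩ := hlen s hs
    obtain ⟨h₃, h₄⟩ := hlen t ht
    simp only [Prod.mk.injEq] at hst
    have e : ∀ x y : ℕ, 16 * x / U = 16 * y / U → 16 * (x : ℤ) < 16 * y + U := by
      intro x y h
      have : (16 * x : ℤ) / U = (16 * y : ℤ) / U := by exact_mod_cast h
      have := Int.sub_lt_of_ediv_eq (by exact_mod_cast hpos) this
      omega
    have d₁ := (hF s hs t ht).2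
    have d₂ := (hF t ht s hs).2
    rw [(hF s hs r hr).1, ← hU] at d₁
    rw [(hF t ht r hr).1, ← hU] at d₂
    exact hclose s (hFS hs) t (hFS ht) U (by omega) (by omega) (by omega) (by omega)
      (e _ _ hst.1) (e _ _ hst.1.symm) (e _ _ hst.2) (e _ _ hst.2.symm)

/-- For close repeats with distinct periods, the overlap of the left copies would be a periodic
core, with the difference of the periods as its period. -/
theorem card_le_of_not_hasPeriodicCore (S : Finset RepeatData)
    (hS : ∀ s ∈ S, IsMaxRepeat f n N s) (h : ∀ s ∈ S, ¬ HasPeriodicCore f s) :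
    S.card ≤ (32 * (32 * N + 1)) * (2 * ((16 + 1) * n)) := by
  refine card_le_of_close S hS ?_
  intro s hs t ht U hUs hUt i₁ i₂ l₁ l₂ p₁ p₂
  wlog hle : (t.period : ℤ) ≤ s.period generalizing s t
  · exact (this t ht s hs hUt hUs i₂ i₁ l₂ l₁ p₂ p₁ (by omega)).symm
  have ms := hS s hs
  have mt := hS t ht
  rcases hle.eq_or_lt with hp | hp
  · exact ms.eq_of_period_eq mt hp.symm (by omega) (by omega)
  refine absurd ⟨s.period - t.period, max (s.start : ℤ) t.start,
    min ((s.start : ℤ) + s.copyLen) (t.start + t.copyLen), by omega, by omega, by omega, by omega,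
    by omega, ?_⟩ (h t ht)
  intro x h₁ h₂
  rw [ms.eq x (by omega) (by omega), mt.eq (x + (s.period - t.period)) (by omega) (by omega)]
  congr 1; ring

/-- Close repeats with run pairs have the same run pair. -/
theorem RunPair.unique {s t : RepeatData} {U q a b a' b' r c d c' d' : ℤ}
    (hs : RunPair f s q a b a' b') (ht : RunPair f t r c d c' d')
    (hUs : U ≤ s.copyLen) (hUt : U ≤ t.copyLen)
    (i₁ : 16 * (s.start : ℤ) < 16 * t.start + U) (i₂ : 16 * (t.start : ℤ) < 16 * s.start + U)
    (l₁ : 16 * (s.copyLen : ℤ) < 16 * t.copyLen + U)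
    (l₂ : 16 * (t.copyLen : ℤ) < 16 * s.copyLen + U)
    (p₁ : 16 * (s.period : ℤ) < 16 * t.period + U)
    (p₂ : 16 * (t.period : ℤ) < 16 * s.period + U) : a = c ∧ b = d ∧ a' = c' ∧ b' = d' := by
  obtain ⟨r₁, r₁', s₁, h₁, h₂, h₃, h₄⟩ := hs
  obtain ⟨r₂, r₂', s₂, h₅, h₆, h₇, h₈⟩ := ht
  have q₁ := r₁.pos
  have q₂ := r₂.pos
  obtain ⟨-, e₁, e₂⟩ := r₁.unique r₂ (c := max a c) (d := min b d) (by omega) (by omega)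
    (by omega) (by omega) (by omega)
  obtain ⟨-, e₃, e₄⟩ := r₁'.unique r₂' (c := max a' c') (d := min b' d') (by omega) (by omega)
    (by omega) (by omega) (by omega)
  exact ⟨e₁, e₂, e₃, e₄⟩

/-- Close repeats share their run pair, hence also the period `a' - a`. -/
theorem card_le_of_left_matched (S : Finset RepeatData) (hS : ∀ s ∈ S, IsMaxRepeat f n N s)
    (h : ∀ s ∈ S, ∃ q a b a' b', RunPair f s q a b a' b' ∧ a' = a + s.period) :
    S.card ≤ (32 * (32 * N + 1)) * (2 * ((16 + 1) * n)) := by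
  refine card_le_of_close S hS ?_
  intro s hs t ht U hUs hUt i₁ i₂ l₁ l₂ p₁ p₂
  obtain ⟨q, a, b, a', b', hr, e⟩ := h s hs
  obtain ⟨_, _, _, _, _, hr', e'⟩ := h t ht
  obtain ⟨rfl, rfl, rfl, rfl⟩ := hr.unique hr' hUs hUt i₁ i₂ l₁ l₂ p₁ p₂
  exact (hS s hs).eq_of_period_eq (hS t ht) (by omega) (by omega) (by omega)

theorem card_le_of_right_matched (S : Finset RepeatData) (hS : ∀ s ∈ S, IsMaxRepeat f n N s)
    (h : ∀ s ∈ S, ∃ q a b a' b', RunPair f s q a b a' b' ∧ b' = b + s.period) :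
    S.card ≤ (32 * (32 * N + 1)) * (2 * ((16 + 1) * n)) := by
  refine card_le_of_close S hS ?_
  intro s hs t ht U hUs hUt i₁ i₂ l₁ l₂ p₁ p₂
  obtain ⟨q, a, b, a', b', hr, e⟩ := h s hs
  obtain ⟨_, _, _, _, _, hr', e'⟩ := h t ht
  obtain ⟨rfl, rfl, rfl, rfl⟩ := hr.unique hr' hUs hUt i₁ i₂ l₁ l₂ p₁ p₂
  exact (hS s hs).eq_of_period_eq (hS t ht) (by omega) (by omega) (by omega)

end Counting

/-! ### Repeats counted at the scale of the run period -/

section RunScale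

variable {A : Type*} {f : ℤ → Option A} {n N : ℕ}

theorem card_le_of_run_scale (S : Finset RepeatData) (hS : ∀ s ∈ S, IsMaxRepeat f n N s)
    (q : RepeatData → ℤ) (x : RepeatData → ℕ) (M : ℕ) (hq : ∀ s ∈ S, 0 < q s)
    (hq' : ∀ s ∈ S, 16 * q s ≤ s.copyLen) (hx : ∀ s ∈ S, x s < n)
    (hF : ∀ F ⊆ S, ∀ r ∈ F, ∀ Q : ℤ, 0 < Q → (∀ s ∈ F, Q ≤ q s ∧ q s < 2 * Q) →
      (∀ s ∈ F, ∀ t ∈ F, 4 * (x s : ℤ) < 4 * x t + Q) → F.card ≤ M) :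
    S.card ≤ M * (2 * ((4 + 1) * n)) := by
  refine card_le_of_scale S (fun s => Nat.log 2 (q s).toNat) x 4 M n ?_ hx ?_
  · intro s hs
    have h₁ := hq s hs
    have h₂ := hq' s hs
    have h₃ := (hS s hs).end_le
    have h₄ := (two_pow_log_toNat h₁).1
    have : (2 : ℤ) ^ Nat.log 2 (q s).toNat ≤ n := by omega
    exact_mod_cast this
  · intro F hFS hF'
    rcases F.eq_empty_or_nonempty with rfl | ⟨r, hr⟩
    · simp
    refine hF F hFS r hr (2 ^ Nat.log 2 (q r).toNat) (by positivity) ?_ ?_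
    · intro s hs
      rw [← (hF' s hs r hr).1]
      exact two_pow_log_toNat (hq s (hFS hs))
    · intro s hs t ht
      have h := (hF' s hs t ht).2
      rw [(hF' s hs r hr).1] at h
      exact_mod_cast h

/-- Repeats whose copies lie in runs with the same period are determined by the approximate ratio
of the period to the length, once the left run and the approximate left copy are known. -/
theorem card_le_of_inner (F : Finset RepeatData) (hF : ∀ s ∈ F, IsMaxRepeat f n N s)
    {q a b : ℤ} (a' b' : RepeatData → ℤ)
    (h : ∀ s ∈ F, InnerRunPair f s q a b (a' s) (b' s))
    (hi : ∀ s ∈ F, ∀ t ∈ F, 4 * (s.start : ℤ) < 4 * t.start + q)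
    (hl : ∀ s ∈ F, ∀ t ∈ F, 4 * (s.copyLen : ℤ) < 4 * t.copyLen + q)
    (hp : ∀ s ∈ F, ∀ t ∈ F, a' s = a' t → b' s = b' t → (s.period : ℤ) < t.period + q) :
    F.card ≤ 8 * N + 1 := by
  rcases F.eq_empty_or_nonempty with rfl | ⟨r, hr⟩
  · simp
  have hpos := (hF r hr).copyLen_pos
  have hsr := (h r hr).short
  have hq := (h r hr).run.pos
  -- Equal keys bring the periods within a quarter of `r.copyLen`; the right copies then overlap
  -- enough to share a run, and `hp` sharpens the difference to below q.
  refine card_le_of_int_key F (fun s => 4 * s.period / r.copyLen) _ ?_ ?_ ?_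
  · intro s hs
    positivity
  · intro s hs
    have h₁ := (hF s hs).period_le
    have h₂ := hl s hs r hr
    have h₃ : (N : ℤ) * s.copyLen ≤ N * (2 * r.copyLen) :=
      mul_le_mul_of_nonneg_left (by omega) (by positivity)
    refine Int.ediv_lt_of_lt_mul hpos ?_
    push_cast
    nlinarith
  · intro s hs t ht e
    have d₁ := Int.sub_lt_of_ediv_eq hpos e
    have d₂ := Int.sub_lt_of_ediv_eq hpos e.symm
    have i₁ := hi s hs t ht
    have i₂ := hi t ht s hs
    have l₁ := hl s hs t ht
    have l₂ := hl t ht s hs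
    have l₃ := hl r hr t ht
    have l₄ := hl r hr s hs
    obtain ⟨r₁, r₁', s₁, h₁, h₂, h₃, h₄⟩ := h s hs
    obtain ⟨-, r₂', s₂, h₅, h₆, h₇, h₈⟩ := h t ht
    obtain ⟨-, ea, eb⟩ := r₁'.unique r₂' (c := max (a' s) (a' t)) (d := min (b' s) (b' t))
      (by omega) (by omega) (by omega) (by omega) (by omega)
    have p₁ := hp s hs t ht ea eb
    have p₂ := hp t ht s hs ea.symm eb.symm
    exact (hF s hs).eq_of_left_run (hF t ht) r₁ h₁ h₂ h₅ h₆ (by omega) (by omega) (by omega)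
      (by omega) (by omega) (by omega)

/-- The left run fixes the start, so the end of the left copy serves as position and controls the
length. Given the right run, its end `b'` then controls the period. -/
theorem card_le_of_outer_ends (S : Finset RepeatData) (hS : ∀ s ∈ S, IsMaxRepeat f n N s)
    (h : ∀ s ∈ S, ∃ q a b a' b', InnerRunPair f s q a b a' b' ∧ a = s.start ∧
      b' = s.start + s.period + s.copyLen) :
    S.card ≤ (8 * N + 1) * (2 * ((4 + 1) * n)) := by
  choose! q a b a' b' h using h
  refine card_le_of_run_scale S hS q (fun s => s.start + s.copyLen) _
    (fun s hs => (h s hs).1.run.pos) (fun s hs => (h s hs).1.short) ?_ ?_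
  · intro s hs
    have h₁ := (hS s hs).lt_period
    have h₂ := (hS s hs).end_le
    omega
  intro F hFS r hr Q hQ hqQ hx
  have same : ∀ s ∈ F, q s = q r ∧ a s = a r ∧ b s = b r := by
    intro s hs
    have h₁ := hqQ s hs
    have h₂ := hqQ r hr
    have h₃ := hx s hs r hr
    have h₄ := hx r hr s hs
    obtain ⟨⟨r₁, -, s₁, g₁, g₂, -, -⟩, -, -⟩ := h s (hFS hs)
    obtain ⟨⟨r₂, -, s₂, g₃, g₄, -, -⟩, -, -⟩ := h r (hFS hr)
    push_cast at h₃ h₄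
    exact r₁.unique r₂ (c := max (a s) (a r)) (d := min (b s) (b r)) (by omega) (by omega)
      (by omega) (by omega) (by omega)
  have hQr := hqQ r hr
  refine card_le_of_inner F (fun s hs => hS s (hFS hs)) (q := q r) (a := a r) (b := b r) a' b'
    ?_ ?_ ?_ ?_
  · intro s hs
    obtain ⟨e₁, e₂, e₃⟩ := same s hs
    rw [← e₁, ← e₂, ← e₃]
    exact (h s (hFS hs)).1
  all_goals
    intro s hs t ht
    have e₁ := same s hs
    have e₂ := same t ht
    have e₃ := h s (hFS hs)
    have e₄ := h t (hFS ht)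
    have e₅ := hx s hs t ht
    have e₆ := hx t ht s hs
    push_cast at e₅ e₆
    omega

/-- Here the left run fixes the end of the left copy, so the start serves as position; the period is
controlled by `a'`. -/
theorem card_le_of_inner_ends (S : Finset RepeatData) (hS : ∀ s ∈ S, IsMaxRepeat f n N s)
    (h : ∀ s ∈ S, ∃ q a b a' b', InnerRunPair f s q a b a' b' ∧ a' = s.start + s.period ∧
      b = s.start + s.copyLen) :
    S.card ≤ (8 * N + 1) * (2 * ((4 + 1) * n)) := by
  choose! q a b a' b' h using h
  refine card_le_of_run_scale S hS q (fun s => s.start) _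
    (fun s hs => (h s hs).1.run.pos) (fun s hs => (h s hs).1.short) ?_ ?_
  · intro s hs
    have h₁ := (hS s hs).lt_period
    have h₂ := (hS s hs).end_le
    omega
  intro F hFS r hr Q hQ hqQ hx
  have same : ∀ s ∈ F, q s = q r ∧ a s = a r ∧ b s = b r := by
    intro s hs
    have h₁ := hqQ s hs
    have h₂ := hqQ r hr
    have h₃ := hx s hs r hr
    have h₄ := hx r hr s hs
    obtain ⟨⟨r₁, -, s₁, g₁, g₂, -, -⟩, -, -⟩ := h s (hFS hs)
    obtain ⟨⟨r₂, -, s₂, g₃, g₄, -, -⟩, -, -⟩ := h r (hFS hr)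
    exact r₁.unique r₂ (c := max (a s) (a r)) (d := min (b s) (b r)) (by omega) (by omega)
      (by omega) (by omega) (by omega)
  have hQr := hqQ r hr
  refine card_le_of_inner F (fun s hs => hS s (hFS hs)) (q := q r) (a := a r) (b := b r) a' b'
    ?_ ?_ ?_ ?_
  · intro s hs
    obtain ⟨e₁, e₂, e₃⟩ := same s hs
    rw [← e₁, ← e₂, ← e₃]
    exact (h s (hFS hs)).1
  all_goals
    intro s hs t ht
    have e₁ := same s hs
    have e₂ := same t ht
    have e₃ := h s (hFS hs)
    have e₄ := h t (hFS ht)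
    have e₅ := hx s hs t ht
    have e₆ := hx t ht s hs
    omega

/-- Repeats one copy of which is a run, `y` being the start position of that copy. -/
theorem card_le_of_run_copy (S : Finset RepeatData) (hS : ∀ s ∈ S, IsMaxRepeat f n N s)
    (hN : 0 < N) (y : RepeatData → ℕ) (hy : ∀ s ∈ S, y s + s.copyLen ≤ n)
    (h : ∀ s ∈ S, ∃ q a b, IsRun f q a b ∧ 16 * q ≤ s.copyLen ∧ a = y s ∧
      b = y s + s.copyLen)
    (heq : ∀ s ∈ S, ∀ t ∈ S, ∀ q, IsRun f q (y s) (y s + s.copyLen) → 16 * q ≤ s.copyLen →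
      y s = y t → s.copyLen = t.copyLen → (s.period : ℤ) - t.period < q →
      (t.period : ℤ) - s.period < q → s = t) :
    S.card ≤ (8 * N + 1) * (2 * ((4 + 1) * n)) := by
  choose! q a b h using h
  have hdiv : ∀ s ∈ S, s.period / (2 * N) ≤ s.copyLen / 2 := by
    intro s hs
    have h₁ : s.period ≤ N * s.copyLen := by exact_mod_cast (hS s hs).period_le
    rw [mul_comm 2 N, ← Nat.div_div_eq_div_mul]
    exact Nat.div_le_div_right (Nat.div_le_of_le_mul h₁)
  -- The run alone leaves the period free, so the position encodes it: `period / (2 * N)` is at most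
  -- half the copy length, and the shift by a quarter keeps the point well inside the run. Nearby
  -- points therefore force the same run.
  refine card_le_of_run_scale S hS q
    (fun s => y s + s.copyLen / 4 + s.period / (2 * N)) _
    (fun s hs => (h s hs).1.pos) (fun s hs => (h s hs).2.1) ?_ ?_
  · intro s hs
    have h₁ := (hS s hs).copyLen_pos
    have h₂ := hy s hs
    have h₃ := hdiv s hs
    omega
  intro F hFS r hr Q hQ hqQ hx
  have same : ∀ s ∈ F, q s = q r ∧ a s = a r ∧ b s = b r := by
    intro s hs
    have h₁ := hqQ s hs
    have h₂ := hqQ r hr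
    have h₃ := hx s hs r hr
    have h₄ := hx r hr s hs
    have h₅ := hdiv s (hFS hs)
    have h₆ := hdiv r (hFS hr)
    obtain ⟨r₁, s₁, g₁, g₂⟩ := h s (hFS hs)
    obtain ⟨r₂, s₂, g₃, g₄⟩ := h r (hFS hr)
    refine r₁.unique r₂ (c := max (a s) (a r)) (d := min (b s) (b r)) (by omega) (by omega)
      (by omega) (by omega) ?_
    generalize s.period / (2 * N) = u at *
    generalize r.period / (2 * N) = v at *
    omega
  have hN' : (0 : ℤ) < 2 * N := by omega
  have near : ∀ s ∈ F, ∀ t ∈ F, (s.period : ℤ) < t.period + 4 * N * Q := by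
    intro s hs t ht
    have e₁ := same s hs
    have e₂ := same t ht
    have e₃ := h s (hFS hs)
    have e₄ := h t (hFS ht)
    have e₅ := hx s hs t ht
    have m₁ := Int.mul_ediv_add_emod (s.period : ℤ) (2 * N)
    have m₂ := Int.mul_ediv_add_emod (t.period : ℤ) (2 * N)
    have m₃ := Int.emod_lt_of_pos (s.period : ℤ) hN'
    have m₄ := Int.emod_nonneg (t.period : ℤ) hN'.ne'
    push_cast at e₅
    generalize (s.period : ℤ) / (2 * N) = u at *
    generalize (t.period : ℤ) / (2 * N) = v at *
    have m₅ : u + 1 ≤ v + 2 * Q := by omega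
    have := mul_le_mul_of_nonneg_left m₅ hN'.le
    nlinarith
  -- The periods lie within 4NQ of that of `r`; those in the same block of length Q differ by less
  -- than Q ≤ q.
  refine card_le_of_int_key F (fun s => (s.period - r.period + 4 * N * Q) / Q) _ ?_ ?_ ?_
  · intro s hs
    have := near r hr s hs
    exact Int.ediv_nonneg (by linarith) hQ.le
  · intro s hs
    have := near s hs r hr
    refine Int.ediv_lt_of_lt_mul hQ ?_
    push_cast
    nlinarith
  · intro s hs t ht e
    have d₁ := Int.sub_lt_of_ediv_eq hQ e
    have d₂ := Int.sub_lt_of_ediv_eq hQ e.symm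
    have e₁ := same s hs
    have e₂ := same t ht
    have e₃ := h s (hFS hs)
    have e₄ := h t (hFS ht)
    have e₅ := hqQ s hs
    refine heq s (hFS hs) t (hFS ht) (q s) ?_ e₃.2.1 (by omega) (by omega) (by linarith)
      (by linarith)
    rw [← e₃.2.2.2, ← e₃.2.2.1]
    exact e₃.1

theorem card_le_of_left_run_copy (S : Finset RepeatData) (hS : ∀ s ∈ S, IsMaxRepeat f n N s)
    (hN : 0 < N) (h : ∀ s ∈ S, ∃ q a b, IsRun f q a b ∧ 16 * q ≤ s.copyLen ∧ a = s.start ∧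
      b = s.start + s.copyLen) :
    S.card ≤ (8 * N + 1) * (2 * ((4 + 1) * n)) := by
  refine card_le_of_run_copy S hS hN (fun s => s.start) ?_ h ?_
  · intro s hs
    have := (hS s hs).end_le
    omega
  · intro s hs t ht q hr hq h₁ h₂ h₃ h₄
    have := hr.pos
    exact (hS s hs).eq_of_left_run (hS t ht) hr (by omega) (by omega) (by omega) (by omega) h₃ h₄
      (by omega) (by omega) (by omega) (by omega)

theorem card_le_of_right_run_copy (S : Finset RepeatData) (hS : ∀ s ∈ S, IsMaxRepeat f n N s)
    (hN : 0 < N) (h : ∀ s ∈ S, ∃ q a b, IsRun f q a b ∧ 16 * q ≤ s.copyLen ∧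
      a = s.start + s.period ∧ b = s.start + s.period + s.copyLen) :
    S.card ≤ (8 * N + 1) * (2 * ((4 + 1) * n)) := by
  refine card_le_of_run_copy S hS hN (fun s => s.start + s.period) ?_ (by simpa using h) ?_
  · intro s hs
    have := (hS s hs).end_le
    omega
  · intro s hs t ht q hr hq h₁ h₂ h₃ h₄
    have := hr.pos
    exact (hS s hs).eq_of_right_run (hS t ht) hr (by omega) (by omega) (by omega) (by omega) h₃ h₄
      (by omega) (by omega) (by omega) (by omega)

theorem card_maxRepeats_le (hf : ∀ t, f t = none ↔ t < 0 ∨ (n : ℤ) ≤ t) (hN : 0 < N)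
    (S : Finset RepeatData) (hS : ∀ s ∈ S, IsMaxRepeat f n N s) :
    S.card ≤ 3 * ((32 * (32 * N + 1)) * (2 * ((16 + 1) * n))) +
      4 * ((8 * N + 1) * (2 * ((4 + 1) * n))) := by
  classical
  have split : ∀ (P Q : RepeatData → Prop) (S : Finset RepeatData) (x y : ℕ),
      (∀ s ∈ S, P s ∨ Q s) → (∀ T ⊆ S, (∀ s ∈ T, P s) → T.card ≤ x) →
      (∀ T ⊆ S, (∀ s ∈ T, Q s) → T.card ≤ y) → S.card ≤ x + y := by
    intro P Q S x y h hx hy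
    have : S = S.filter P ∪ S.filter Q := by
      rw [← Finset.filter_or]
      exact (Finset.filter_true_of_mem h).symm
    rw [this]
    exact (Finset.card_union_le _ _).trans (Nat.add_le_add
      (hx _ (Finset.filter_subset _ _) fun s hs => (Finset.mem_filter.1 hs).2)
      (hy _ (Finset.filter_subset _ _) fun s hs => (Finset.mem_filter.1 hs).2))
  set x := (32 * (32 * N + 1)) * (2 * ((16 + 1) * n))
  set y := (8 * N + 1) * (2 * ((4 + 1) * n))
  suffices S.card ≤ x + (x + (x + (y + (y + (y + y))))) by omega
  refine split _ _ S _ _ (fun s hs => (hS s hs).classification hf)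
    (fun T hT h => card_le_of_not_hasPeriodicCore T (fun s hs => hS s (hT hs)) h) ?_
  intro T hT h
  replace hS := fun s hs => hS s (hT hs)
  refine split _ _ T _ _ h
    (fun T hT h => card_le_of_left_matched T (fun s hs => hS s (hT hs)) h) ?_
  clear! S
  intro S hT h
  replace hS := fun s hs => hS s (hT hs)
  refine split _ _ S _ _ h
    (fun T hT h => card_le_of_right_matched T (fun s hs => hS s (hT hs)) h) ?_
  clear! T
  intro T hT h
  replace hS := fun s hs => hS s (hT hs)
  refine split _ _ T _ _ h
    (fun T hT h => card_le_of_outer_ends T (fun s hs => hS s (hT hs)) h) ?_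
  clear! S
  intro S hT h
  replace hS := fun s hs => hS s (hT hs)
  refine split _ _ S _ _ h
    (fun T hT h => card_le_of_inner_ends T (fun s hs => hS s (hT hs)) h) ?_
  clear! T
  intro T hT h
  replace hS := fun s hs => hS s (hT hs)
  exact split _ _ T _ _ h
    (fun T hT h => card_le_of_left_run_copy T (fun s hs => hS s (hT hs)) hN h)
    (fun T hT h => card_le_of_right_run_copy T (fun s hs => hS s (hT hs)) hN h)

end RunScale

/-! ### The final bound -/

theorem finite_maximalGappedRepeats {A : Type*} (α : ℝ) (w : List A) :
    (maximalGappedRepeats α w).Finite := by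
  refine (((Set.finite_Iic w.length).prod ((Set.finite_Iic w.length).prod
    (Set.finite_Iic w.length))).image fun x => RepeatData.mk x.1 x.2.1 x.2.2).subset ?_
  rintro ⟨i, l, g⟩ ⟨h, -⟩
  have := h.rightStop_le
  simp only [RepeatData.rightStop, RepeatData.rightStart, RepeatData.period] at this
  exact ⟨(i, l, g), ⟨by simp; omega, by simp; omega, by simp; omega⟩, rfl⟩

theorem lemma7 :
    ∃ C : ℝ, ∀ (A : Type*) (α : ℝ), 1 < α → ∀ w : List A,
      (maximalGappedRepeats α w).Finite ∧
        ((maximalGappedRepeats α w).ncard : ℝ) ≤ C * α ^ 2 * (w.length : ℝ) := by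
  refine ⟨216144, fun A α hα w => ⟨finite_maximalGappedRepeats α w, ?_⟩⟩
  have hfin := finite_maximalGappedRepeats α w
  have hN : 0 < ⌈α⌉₊ := Nat.ceil_pos.2 (by linarith)
  rw [Set.ncard_eq_toFinset_card _ hfin]
  have h := card_maxRepeats_le (letterAt_eq_none w) hN hfin.toFinset fun s hs => by
    obtain ⟨h₁, h₂⟩ := hfin.mem_toFinset.1 hs
    refine h₁.isMaxRepeat ?_
    have : (s.period : ℝ) ≤ ⌈α⌉₊ * s.copyLen :=
      h₂.trans (mul_le_mul_of_nonneg_right (Nat.le_ceil α) (by positivity))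
    exact_mod_cast this
  -- The count is linear in ⌈α⌉; the square enters only here.
  have hα' : (⌈α⌉₊ : ℝ) ≤ 2 * α ^ 2 := by
    have := Nat.ceil_lt_add_one (a := α) (by linarith)
    nlinarith
  -- With N ≥ 1, 32N + 1 ≤ 33N and 8N + 1 ≤ 9N, and 108072 = 3·32·33·34 + 4·9·10.
  have h' : hfin.toFinset.card ≤ 108072 * (⌈α⌉₊ * w.length) := by nlinarith
  calc (hfin.toFinset.card : ℝ) ≤ 108072 * (⌈α⌉₊ * w.length) := by exact_mod_cast h'
    _ ≤ 108072 * (2 * α ^ 2 * w.length) := by gcongr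
    _ = 216144 * α ^ 2 * w.length := by ring
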